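/- For a family $\mathcal I$ of subsets of a set $X$, let $\mathrm{cov}(\mathcal I)=\min\{|\mathcal A| : \mathcal A\subseteq\mathcal I,\ \bigcup\mathcal A=X\}$, with $\mathrm{cov}(\mathcal I)=\infty$ (larger than every cardinal) if no such $\mathcal A$ exists. For a measure $\mu$ on $X$, let $\mathrm{cov}(\mu)$ be the covering number of the ideal of all $\mu$-null subsets of $X$ (all subsets of measurable sets of measure zero). Let $\mathcal N_{\omega_1}$ be the ideal of null subsets of $2^{\omega_1}$ with respect to the standard product measure $\lambda_{\omega_1}$ (the product of $\omega_1$ copies of the uniform probability measure on $\{0,1\}$). If $\mathrm{cov}(\mathcal N_{\omega_1})>\omega_1$, then $\mathrm{cov}(\mu)>\omega_1$ for every nonzero finite Radon measure $\mu$ on a compact Hausdorff space $K$, that is, for every nonzero finite Borel measure $\mu$ on $K$ that is inner regular with respect to compact sets. -/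

import Mathlib

open MeasureTheory
open scoped Cardinal

/-- The covering number `cov(I)`: the least cardinality of a subfamily of `I` with union the whole
space. It is `⊤` when no subfamily of `I` covers the space. -/
noncomputable def cov {X : Type*} (I : Set (Set X)) : WithTop Cardinal :=
  ⨅ A ∈ {A : Set (Set X) | A ⊆ I ∧ ⋃₀ A = Set.univ}, ((#A : Cardinal) : WithTop Cardinal)

/-- The ideal of `μ`-null sets. Mathlib evaluates `μ` on an arbitrary set as an outer measure, so
this consists of all subsets of measurable sets of measure zero. -/
def nullIdeal {X : Type*} [MeasurableSpace X] (μ : Measure X) : Set (Set X) :=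
  {N | μ N = 0}

/-- The standard product measure on `2^ι`: the product of the uniform probability measures on the
two-point set. It is given on the product `σ`-algebra, over which the Borel sets of `2^ι` are
measurable up to completion, so its null subsets are those of its Borel extension. -/
noncomputable def cantorMeasure (ι : Type*) : Measure (ι → Bool) :=
  Measure.infinitePi fun _ : ι => (PMF.uniformOfFintype Bool).toMeasure

/-- The ideal `N_κ` of null subsets of `2^κ`, where the cardinal `κ` is represented by a type of
cardinality `κ`. -/
noncomputable def nullIdealCantor (κ : Cardinal) : Set (Set (κ.out → Bool)) :=
  nullIdeal (cantorMeasure κ.out)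

open ProbabilityTheory Filter Topology Set

/-! Normalise `μ` and let `N t`, for `t` in a set `T` of size `ℵ₁`, be null sets. Inner regularity
gives compact sets `F t n` disjoint from `N t` with `⨆ n, μ (F t n) = 1`. Their indicators have a
copy `f` on `2^T` with the same joint law (`exists_measurable_map_cantorMeasure_eq`). Only `#T` many
null events of `2^T` matter: for each `t`, that all `f x (t, n)` are false; for each finite `s` with
null intersection of the `F`, that `f x` is true on all of `s`. A point `x` outside them selects
some `n t` for each `t`, so that finitely many `F t (n t)` always meet. By compactness all of them
meet, and a common point avoids every `N t`.

The copy is built along a well-order of the indices: each variable is a function of its predecessors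
and a fresh uniform variable, which is made from countably many coins. -/

/-! ### Uniform variables from coin tosses -/

theorem continuous_cdf (m : Measure ℝ) [IsProbabilityMeasure m] [NullSingletonClass m] :
    Continuous (cdf m) := by
  refine continuous_iff_continuousAt.2 fun a => ?_
  rw [(monotone_cdf m).continuousAt_iff_leftLim_eq_rightLim, StieltjesFunction.rightLim_eq]
  have h := (cdf m).measure_singleton a
  rw [measure_cdf, measure_singleton, eq_comm, ENNReal.ofReal_eq_zero, sub_nonpos] at h
  exact le_antisymm ((monotone_cdf m).leftLim_le le_rfl) h

theorem exists_cdf_eq (m : Measure ℝ) [IsProbabilityMeasure m] [NullSingletonClass m] {p : ℝ}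
    (hp : p ∈ Ioo (0 : ℝ) 1) : ∃ t, cdf m t = p := by
  obtain ⟨a, ha⟩ := ((tendsto_cdf_atBot m).eventually (gt_mem_nhds hp.1)).exists
  obtain ⟨b, hb⟩ := ((tendsto_cdf_atTop m).eventually (lt_mem_nhds hp.2)).exists
  exact mem_range_of_exists_le_of_exists_ge (continuous_cdf m) ⟨a, ha.le⟩ ⟨b, hb.le⟩

theorem measure_cdf_le (m : Measure ℝ) [IsProbabilityMeasure m] [NullSingletonClass m] {p : ℝ}
    (hp : p ∈ Icc (0 : ℝ) 1) : m {x | cdf m x ≤ p} = ENNReal.ofReal p := by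
  apply le_antisymm
  · rcases hp.2.eq_or_lt with rfl | hp1
    · simpa using prob_le_one
    refine ge_of_tendsto (x := 𝓝[>] p) (f := fun q => ENNReal.ofReal q) ?_ ?_
    · exact (ENNReal.continuous_ofReal.tendsto p).mono_left nhdsWithin_le_nhds
    -- The level set of `p` may extend to the right of a point where the cdf equals `p`, but it
    -- stays to the left of any point where the cdf equals `q > p`.
    · filter_upwards [Ioo_mem_nhdsGT hp1] with q hq
      obtain ⟨t, ht⟩ := exists_cdf_eq m ⟨hp.1.trans_lt hq.1, hq.2⟩
      rw [← ht, ofReal_cdf]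
      refine measure_mono fun x (hx : cdf m x ≤ p) => ?_
      by_contra hxt
      have := monotone_cdf m (not_le.1 hxt).le
      linarith [hq.1]
  · rcases hp.1.eq_or_lt with rfl | hp0
    · simp
    rcases hp.2.eq_or_lt with rfl | hp1
    · simp [cdf_le_one]
    obtain ⟨t, ht⟩ := exists_cdf_eq m ⟨hp0, hp1⟩
    rw [← ht, ofReal_cdf]
    exact measure_mono fun x hx => monotone_cdf m hx

/-- An atomless probability measure on a standard Borel space can be mapped onto the uniform
measure of the unit interval. -/
theorem exists_measurable_map_eq_volume {Y : Type*} [MeasurableSpace Y] [StandardBorelSpace Y]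
    (m : Measure Y) [IsProbabilityMeasure m] [NullSingletonClass m] :
    ∃ u : Y → unitInterval, Measurable u ∧ m.map u = volume := by
  have he := measurableEmbedding_embeddingReal Y
  set ν := m.map (embeddingReal Y) with hν
  have : IsProbabilityMeasure ν := Measure.isProbabilityMeasure_map he.measurable.aemeasurable
  have : NullSingletonClass ν := by
    refine ⟨fun x => ?_⟩
    rw [hν, he.map_apply]
    exact (subsingleton_singleton.preimage he.injective).measure_zero m
  let F : ℝ → unitInterval := fun x => ⟨cdf ν x, cdf_nonneg ν x, cdf_le_one ν x⟩
  have hF : Measurable F := (monotone_cdf ν).measurable.subtype_mk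
  refine ⟨F ∘ embeddingReal Y, hF.comp he.measurable, ?_⟩
  rw [← Measure.map_map hF he.measurable, ← hν]
  have : IsProbabilityMeasure (ν.map F) := Measure.isProbabilityMeasure_map hF.aemeasurable
  refine Measure.ext_of_Iic _ _ fun p => ?_
  rw [Measure.map_apply hF measurableSet_Iic, unitInterval.volume_Iic, ← measure_cdf_le ν p.2]
  rfl

/-- A point lies in cylinders of measure `2⁻¹ ^ n` for every `n`. -/
instance nullSingletonClass_cantorMeasure : NullSingletonClass (cantorMeasure ℕ) := by
  refine ⟨fun x => ?_⟩
  refine le_antisymm (ge_of_tendsto (f := fun n : ℕ => (2⁻¹ : ENNReal) ^ n)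
    (ENNReal.tendsto_pow_atTop_nhds_zero_of_lt_one (by simp))
    (Eventually.of_forall fun n => ?_)) bot_le
  have := Measure.infinitePi_pi (fun _ : ℕ => (PMF.uniformOfFintype Bool).toMeasure)
    (s := Finset.range n) (t := fun i => {x i}) (by simp)
  rw [Finset.prod_congr rfl (g := fun _ => 2⁻¹)] at this
  · rw [Finset.prod_const, Finset.card_range] at this
    rw [← this]
    exact measure_mono (by rintro _ rfl; simp)
  · intro i _
    simp

/-- The uniform measure on a power of the unit interval is an image of the coin-tossing measure. -/
theorem exists_measurable_map_cantorMeasure {T I : Type*} (e : I × ℕ ≃ T) :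
    ∃ U : (T → Bool) → I → unitInterval, Measurable U ∧
      (cantorMeasure T).map U = Measure.infinitePi fun _ : I => volume := by
  have : IsProbabilityMeasure (cantorMeasure ℕ) := by unfold cantorMeasure; infer_instance
  obtain ⟨u, hu, hm⟩ := exists_measurable_map_eq_volume (cantorMeasure ℕ)
  let b : Measure Bool := (PMF.uniformOfFintype Bool).toMeasure
  have h1 := Measure.infinitePi_map_piCongrLeft (X := fun _ : I × ℕ => Bool) (fun _ => b) e.symm
  have h2 := Measure.infinitePi_map_curry (ι := I) (κ := ℕ) (X := Bool) (fun _ _ => b)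
  have h3 := Measure.infinitePi_map_pi (X := fun _ : I => ℕ → Bool) (fun _ => cantorMeasure ℕ)
    (fun _ => hu)
  simp only [hm] at h3
  rw [← h3]
  refine ⟨fun x i => u fun n => x (e (i, n)), ?_, ?_⟩
  · fun_prop
  · unfold cantorMeasure
    rw [← h2, ← h1, Measure.map_map (by fun_prop) (by fun_prop),
      Measure.map_map (by fun_prop) (by fun_prop)]
    congr 1
    ext x i
    refine congrArg (fun w => (u w : ℝ)) (funext fun n => ?_)
    have := Equiv.piCongrLeft_apply_apply (fun _ : I × ℕ => Bool) e.symm x (e (i, n))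
    rw [e.symm_apply_apply] at this
    exact this.symm

/-! ### Realizing joint laws by transfinite recursion -/

section
variable {I Y : Type*} [LinearOrder I] [WellFoundedLT I]

/-- The sequence determined by the innovations `x` through the recursive rules `φ`. -/
noncomputable def transfiniteRec (φ : ∀ i : I, (Iio i → Y) → unitInterval → Y)
    (x : I → unitInterval) : I → Y :=
  wellFounded_lt.fix fun i r => φ i (fun j => r j j.2) (x i)

theorem transfiniteRec_eq (φ : ∀ i : I, (Iio i → Y) → unitInterval → Y)
    (x : I → unitInterval) (i : I) :
    transfiniteRec φ x i = φ i (fun j => transfiniteRec φ x j) (x i) := by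
  unfold transfiniteRec
  rw [WellFounded.fix_eq]

variable [MeasurableSpace Y]

/-- The value at `i` uses only the innovations up to `i`; this sharp form is what makes the earlier
values independent of the innovation at `i`. -/
theorem measurable_transfiniteRec_iSup {φ : ∀ i : I, (Iio i → Y) → unitInterval → Y}
    (hφ : ∀ i, Measurable (Function.uncurry (φ i))) (i : I) :
    Measurable[⨆ j ∈ Iic i, MeasurableSpace.comap (fun x : I → unitInterval => x j) inferInstance]
      fun x => transfiniteRec φ x i := by
  induction i using WellFoundedLT.induction with
  | ind i ih =>
    simp_rw [transfiniteRec_eq φ _ i]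
    refine (hφ i).comp (Measurable.prodMk (@measurable_pi_lambda _ _ _ (_) _ _ fun j => ?_) ?_)
    · refine (ih j j.2).mono (biSup_mono fun k hk => ?_) le_rfl
      exact le_trans (mem_Iic.1 hk) (le_of_lt j.2)
    · exact (comap_measurable _).mono (le_biSup (fun j => MeasurableSpace.comap
        (fun x : I → unitInterval => x j) inferInstance) (mem_Iic.2 le_rfl)) le_rfl

theorem measurable_transfiniteRec {φ : ∀ i : I, (Iio i → Y) → unitInterval → Y}
    (hφ : ∀ i, Measurable (Function.uncurry (φ i))) (i : I) :
    Measurable fun x => transfiniteRec φ x i :=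
  (measurable_transfiniteRec_iSup hφ i).mono
    (iSup₂_le fun j _ => (measurable_pi_apply j).comap_le) le_rfl

theorem indepFun_transfiniteRec {φ : ∀ i : I, (Iio i → Y) → unitInterval → Y}
    (hφ : ∀ i, Measurable (Function.uncurry (φ i))) (i : I) :
    IndepFun (fun x (j : Iio i) => transfiniteRec φ x j) (fun x => x i)
      (Measure.infinitePi fun _ : I => (volume : Measure unitInterval)) := by
  have h := indep_iSup_of_disjoint (fun j => (measurable_pi_apply j).comap_le)
    (iIndepFun_infinitePi (P := fun _ : I => (volume : Measure unitInterval))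
      (X := fun _ x => x) (by fun_prop)) (S := Iio i) (T := {i}) (by simp)
  refine indep_of_indep_of_le_left (indep_of_indep_of_le_right h ?_) ?_
  · exact le_iSup₂_of_le i rfl le_rfl
  · refine Measurable.comap_le (@measurable_pi_lambda _ _ _ (_) _ _ fun j => ?_)
    refine (measurable_transfiniteRec_iSup hφ j).mono (biSup_mono fun k hk => ?_) le_rfl
    exact lt_of_le_of_lt (mem_Iic.1 hk) j.2

end

/-- Two laws on a product agree on a set of coordinates as soon as each of these coordinates has the
same joint law with its predecessors. -/
theorem map_domRestrict_eq_of_map_prod_eq {I Y Ω K : Type*} [LinearOrder I] [MeasurableSpace Y]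
    [MeasurableSpace Ω] [MeasurableSpace K] {P : Measure Ω} {μ : Measure K}
    [IsProbabilityMeasure P] [IsProbabilityMeasure μ] {f : I → Ω → Y} {X : I → K → Y}
    (hf : ∀ i, Measurable (f i)) (hX : ∀ i, Measurable (X i)) (D : Set I)
    (h : ∀ i ∈ D, P.map (fun ω => ((fun j : Iio i => f j ω), f i ω)) =
      μ.map (fun k => ((fun j : Iio i => X j k), X i k))) :
    P.map (fun ω (i : D) => f i ω) = μ.map (fun k (i : D) => X i k) := by
  have hfD : Measurable fun ω (i : D) => f i ω := by fun_prop
  have hXD : Measurable fun k (i : D) => X i k := by fun_prop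
  have := Measure.isProbabilityMeasure_map (μ := P) hfD.aemeasurable
  have := Measure.isProbabilityMeasure_map (μ := μ) hXD.aemeasurable
  refine IsProjectiveLimit.unique
    (P := fun J => (μ.map (fun k (i : D) => X i k)).map J.restrict) (fun J => ?_) fun J => rfl
  have : ∀ J : Finset D, IsProbabilityMeasure ((μ.map (fun k (i : D) => X i k)).map J.restrict) :=
    fun J => Measure.isProbabilityMeasure_map (by fun_prop)
  have : ∀ J : Finset D, IsProbabilityMeasure ((P.map (fun k (i : D) => f i k)).map J.restrict) :=
    fun J => Measure.isProbabilityMeasure_map (by fun_prop)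
  rcases J.eq_empty_or_nonempty with rfl | hJ
  · ext s -
    rcases s.eq_empty_or_nonempty with rfl | hs
    · simp
    · rw [Subsingleton.eq_univ_of_nonempty hs, measure_univ, measure_univ]
  -- The finite set `J` consists of its maximum `i` and predecessors of `i`, so its law is an image
  -- under `r` of the joint law known at `i`.
  · let i := J.max' hJ
    let r : (Iio i.1 → Y) × Y → J → Y := fun z k => if hk : k.1.1 < i.1 then z.1 ⟨k.1.1, hk⟩ else z.2
    have hr : Measurable r := by
      refine measurable_pi_lambda _ fun k => ?_
      by_cases hk : k.1.1 < i.1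
      · simp only [r, hk, dite_true]; fun_prop
      · simp only [r, hk, dite_false]; fun_prop
    have key : ∀ g : I → Y, r ((fun j => g j), g i) = fun k : J => g k := by
      intro g
      ext k
      by_cases hk : k.1.1 < i.1
      · exact dif_pos hk
      · have : k.1 = i := le_antisymm (J.le_max' _ k.2) (not_lt.1 hk)
        simp [r, this]
    have h' := congrArg (Measure.map r) (h i i.2)
    rw [Measure.map_map hr (by fun_prop), Measure.map_map hr (by fun_prop)] at h'
    change (P.map _).map _ = (μ.map _).map _
    rw [Measure.map_map (by fun_prop) hfD, Measure.map_map (by fun_prop) hXD]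
    convert h' using 2
    · ext1 ω; exact (key fun i => f i ω).symm
    · ext1 ω; exact (key fun i => X i ω).symm

/-- Every family of random variables indexed by a well-ordered set can be realized, with the same
joint law, on a power of the unit interval. -/
theorem exists_measurable_map_infinitePi_eq {I Y K : Type*} [LinearOrder I] [WellFoundedLT I]
    [MeasurableSpace Y] [StandardBorelSpace Y] [Nonempty Y] [MeasurableSpace K] (μ : Measure K)
    [IsProbabilityMeasure μ] {X : I → K → Y} (hX : ∀ i, Measurable (X i)) :
    ∃ f : (I → unitInterval) → I → Y, Measurable f ∧
      (Measure.infinitePi fun _ : I => (volume : Measure unitInterval)).map f =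
        μ.map (fun k i => X i k) := by
  choose φ hφ hφm using fun i => Kernel.exists_measurable_map_eq_unitInterval
    (condDistrib (X i) (fun k (j : Iio i) => X j k) μ)
  have hf := measurable_transfiniteRec hφ
  refine ⟨transfiniteRec φ, measurable_pi_lambda _ hf, ?_⟩
  set P := Measure.infinitePi fun _ : I => (volume : Measure unitInterval)
  have step : ∀ i, P.map (fun ω => ((fun j : Iio i => transfiniteRec φ ω j),
      transfiniteRec φ ω i)) = μ.map (fun k => ((fun j : Iio i => X j k), X i k)) := by
    intro i
    induction i using WellFoundedLT.induction with
    | ind i ih =>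
      have hR := map_domRestrict_eq_of_map_prod_eq (P := P) (μ := μ)
        (f := fun i x => transfiniteRec φ x i) hf hX (Iio i) ih
      have hfi : Measurable fun x (j : Iio i) => transfiniteRec φ x j := by fun_prop
      have hφi : Measurable fun z : (Iio i → Y) × unitInterval => (z.1, φ i z.1 z.2) :=
        measurable_fst.prodMk (hφ i)
      -- Both sides become the law of the predecessors followed by the conditional distribution: by
      -- disintegration on `K`, and by independence of the innovation on the cube.
      rw [← compProd_map_condDistrib (hX i).aemeasurable, ← hR]
      have hind := (indepFun_iff_map_prod_eq_prod_map_map hfi.aemeasurable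
        (measurable_pi_apply i).aemeasurable).1 (indepFun_transfiniteRec hφ i)
      rw [Measure.infinitePi_map_eval] at hind
      simp_rw [transfiniteRec_eq φ _ i]
      have : IsProbabilityMeasure (P.map fun x (j : Iio i) => transfiniteRec φ x j) :=
        Measure.isProbabilityMeasure_map hfi.aemeasurable
      rw [show (fun ω => ((fun j : Iio i => transfiniteRec φ ω j),
          φ i (fun j => transfiniteRec φ ω j) (ω i))) =
          (fun z : (Iio i → Y) × unitInterval => (z.1, φ i z.1 z.2)) ∘
            (fun ω : I → unitInterval => ((fun j : Iio i => transfiniteRec φ ω j), ω i)) from rfl,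
        ← Measure.map_map hφi (by fun_prop), hind]
      ext s hs
      rw [Measure.map_apply hφi hs, Measure.prod_apply (hφi hs), Measure.compProd_apply hs]
      refine lintegral_congr fun z => ?_
      rw [← hφm i z, Measure.map_apply (hφ i).of_uncurry_left (measurable_prodMk_left hs)]
      rfl
  have := map_domRestrict_eq_of_map_prod_eq (P := P) (μ := μ)
        (f := fun i x => transfiniteRec φ x i) hf hX univ fun i _ => step i
  have hr : Measurable fun (z : ↥(Set.univ : Set I) → Y) (i : I) => z ⟨i, trivial⟩ := by fun_prop
  have h' := congrArg (Measure.map fun (z : ↥(Set.univ : Set I) → Y) (i : I) => z ⟨i, trivial⟩) this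
  rwa [Measure.map_map hr (by fun_prop), Measure.map_map hr (by fun_prop)] at h'

/-- Every family of random variables whose index set has cardinality at most `#T` has a copy, with
the same joint law, on the space `2^T`. -/
theorem exists_measurable_map_cantorMeasure_eq {T I Y K : Type*} (e : I × ℕ ≃ T)
    [MeasurableSpace Y] [StandardBorelSpace Y] [Nonempty Y] [MeasurableSpace K] (μ : Measure K)
    [IsProbabilityMeasure μ] {X : I → K → Y} (hX : ∀ i, Measurable (X i)) :
    ∃ f : (T → Bool) → I → Y, Measurable f ∧ (cantorMeasure T).map f = μ.map fun k i => X i k := by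
  classical
  let _ : LinearOrder I := linearOrderOfSTO WellOrderingRel
  have : WellFoundedLT I := inferInstanceAs (IsWellFounded I WellOrderingRel)
  obtain ⟨U, hU, hUm⟩ := exists_measurable_map_cantorMeasure e
  obtain ⟨f, hf, hfm⟩ := exists_measurable_map_infinitePi_eq μ hX
  exact ⟨f ∘ U, hf.comp hU, by rw [← Measure.map_map hf hU, hUm, hfm]⟩

/-! ### Null covers and compactness -/

theorem lt_cov_iff {X : Type*} {I : Set (Set X)} {c : Cardinal} :
    (c : WithTop Cardinal) < cov I ↔ ∀ A ⊆ I, ⋃₀ A = univ → c < #A := by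
  unfold cov
  constructor
  · intro h A hA hU
    exact WithTop.coe_lt_coe.1 (h.trans_le (iInf₂_le A ⟨hA, hU⟩))
  · intro h
    -- Passing to the infimum keeps only weak inequalities, so bound below by the successor of `c`.
    refine (WithTop.coe_lt_coe.2 (Order.lt_succ c)).trans_le (le_iInf₂ fun A hA => ?_)
    exact WithTop.coe_le_coe.2 (Order.succ_le_of_lt (h A hA.1 hA.2))

/-- If `cov N > #T`, a family of `#T` many null sets does not cover the space. -/
theorem exists_forall_notMem_of_lt_cov {X T J : Type} {I : Set (Set X)}
    (h : ((#T : Cardinal) : WithTop Cardinal) < cov I) (hJ : #J ≤ #T) {N : J → Set X}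
    (hN : ∀ j, N j ∈ I) : ∃ x, ∀ j, x ∉ N j := by
  by_contra! hx
  refine (lt_cov_iff.1 h (range N) (range_subset_iff.2 hN) ?_).not_ge
    (Cardinal.mk_range_le.trans hJ)
  exact eq_univ_of_forall fun x => let ⟨j, hj⟩ := hx x; ⟨_, ⟨j, rfl⟩, hj⟩

/-- Inner regularity is applied to the complement of a measurable null hull of `N`. -/
theorem exists_isCompact_disjoint_null {K : Type*} [TopologicalSpace K] [T2Space K]
    [MeasurableSpace K] [BorelSpace K] (μ : Measure K) [IsProbabilityMeasure μ] [μ.InnerRegular]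
    {N : Set K} (hN : μ N = 0) :
    ∃ F : ℕ → Set K, (∀ n, IsCompact (F n)) ∧ (∀ n, Disjoint (F n) N) ∧ ⨆ n, μ (F n) = 1 := by
  have hm := (measurableSet_toMeasurable μ N).compl
  have h1 : μ (toMeasurable μ N)ᶜ = 1 := by
    rw [prob_compl_eq_one_iff (measurableSet_toMeasurable μ N), measure_toMeasurable, hN]
  have : ∀ n : ℕ, ∃ F ⊆ (toMeasurable μ N)ᶜ, IsCompact F ∧ 1 - ((n : ENNReal) + 1)⁻¹ < μ F := by
    intro n
    refine hm.exists_lt_isCompact (by rw [h1]; exact ENNReal.sub_lt_self (by simp) (by simp) (by simp))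
  choose F hF hFc hFm using this
  refine ⟨F, hFc, fun n => ?_, le_antisymm (iSup_le fun n => prob_le_one) ?_⟩
  · exact (disjoint_compl_left_iff_subset.2 (subset_toMeasurable μ N)).mono_left (hF n)
  · have ht : Tendsto (fun n : ℕ => (1 : ENNReal) - ((n : ENNReal) + 1)⁻¹) atTop (𝓝 (1 - 0)) := by
      refine ENNReal.Tendsto.sub tendsto_const_nhds ?_ (by simp)
      have := (tendsto_add_atTop_iff_nat 1).2 ENNReal.tendsto_inv_nat_nhds_zero
      simpa using this
    rw [tsub_zero] at ht
    exact le_of_tendsto' ht fun n => (hFm n).le.trans (le_iSup (fun n => μ (F n)) n)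

/-- If `cov` of the null ideal of `2^T` exceeds `#T`, then so does `cov` of the null ideal of every
Radon probability measure: a `T`-indexed family of null sets does not cover. -/
theorem exists_forall_notMem_null_of_lt_cov_cantorMeasure {T : Type} [Infinite T]
    (h : ((#T : Cardinal) : WithTop Cardinal) < cov (nullIdeal (cantorMeasure T)))
    {K : Type*} [TopologicalSpace K] [CompactSpace K] [T2Space K]
    [MeasurableSpace K] [BorelSpace K] (μ : Measure K) [IsProbabilityMeasure μ] [μ.InnerRegular]
    {N : T → Set K} (hN : ∀ t, μ (N t) = 0) : ∃ k, ∀ t, k ∉ N t := by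
  classical
  choose F hFc hFd hFm using fun t => exists_isCompact_disjoint_null μ (hN t)
  have hTN : #(T × ℕ) = #T := by simp
  have hTf : #(Finset (T × ℕ)) = #T := by rw [Cardinal.mk_finset_of_infinite, hTN]
  obtain ⟨e⟩ := Cardinal.eq.1 ((by simp : #((T × ℕ) × ℕ) = #T))
  have hFmeas : ∀ i : T × ℕ, MeasurableSet (F i.1 i.2) := fun i => (hFc i.1 i.2).measurableSet
  let X : T × ℕ → K → Bool := fun i k => decide (k ∈ F i.1 i.2)
  have hX : ∀ i, Measurable (X i) := fun i => measurable_to_bool (by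
    convert hFmeas i using 1; ext k; simp [X])
  obtain ⟨f, hf, hfm⟩ := exists_measurable_map_cantorMeasure_eq e μ hX
  have hXm : Measurable fun k i => X i k := by fun_prop
  have hlaw : ∀ s : Finset (T × ℕ), cantorMeasure T {x | ∀ i ∈ s, f x i = true} =
      μ (⋂ i ∈ s, F i.1 i.2) := by
    intro s
    have hs : MeasurableSet {z : T × ℕ → Bool | ∀ i ∈ s, z i = true} := by
      simp only [ofPred_forall]
      exact s.measurableSet_biInter fun i _ => measurable_pi_apply (X := fun _ => Bool) i (measurableSet_singleton true)
    have := congrArg (fun m : Measure (T × ℕ → Bool) => m {z | ∀ i ∈ s, z i = true}) hfm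
    simp only [Measure.map_apply hf hs, Measure.map_apply hXm hs] at this
    refine this.trans (congrArg μ ?_)
    ext k
    simp [X]
  have hprob : IsProbabilityMeasure (cantorMeasure T) := by unfold cantorMeasure; infer_instance
  let Z : Finset (T × ℕ) ⊕ T → Set (T → Bool) := Sum.elim
    (fun s => if μ (⋂ i ∈ s, F i.1 i.2) = 0 then {x | ∀ i ∈ s, f x i = true} else ∅)
    (fun t => {x | ∀ n, f x (t, n) = false})
  have hZ : ∀ j, Z j ∈ nullIdeal (cantorMeasure T) := by
    rintro (s | t)
    · change cantorMeasure T (if _ then _ else _) = 0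
      split_ifs with h0
      · rw [hlaw, h0]
      · simp
    · change cantorMeasure T {x | ∀ n, f x (t, n) = false} = 0
      have hmeas : MeasurableSet {x | ∀ n, f x (t, n) = false} := by
        simp only [ofPred_forall]
        exact MeasurableSet.iInter fun n =>
          (measurable_pi_apply (t, n)).comp hf (measurableSet_singleton false)
      rw [← prob_compl_eq_one_iff hmeas]
      refine le_antisymm prob_le_one ?_
      rw [← hFm t]
      refine iSup_le fun n => ?_
      have := hlaw {(t, n)}
      simp only [Finset.mem_singleton, iInter_iInter_eq_left, forall_eq] at this
      rw [← this]
      exact measure_mono fun x (hx : f x (t, n) = true) hx' => by simp [hx' n] at hx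
  obtain ⟨x, hx⟩ := exists_forall_notMem_of_lt_cov h (J := Finset (T × ℕ) ⊕ T)
    (by rw [Cardinal.mk_sum, hTf]; simp) hZ
  have hn : ∀ t, ∃ n, f x (t, n) = true := by
    intro t
    by_contra! hcon
    exact hx (Sum.inr t) fun n => by simpa using hcon n
  choose n hn using hn
  have hfip : (⋂ t, F t (n t)).Nonempty := by
    refine isCompact_univ.inter_iInter_nonempty (fun t => F t (n t))
      (fun t => (hFc t (n t)).isClosed) (fun u => ?_) |>.mono inter_subset_right
    rw [univ_inter]
    by_contra hemp
    -- An empty finite intersection is null, hence is one of the configurations that `x` avoids.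
    have h0 : μ (⋂ i ∈ u.image (fun t => (t, n t)), F i.1 i.2) = 0 := by
      rw [Finset.set_biInter_finset_image, not_nonempty_iff_eq_empty.1 hemp, measure_empty]
    refine hx (Sum.inl (u.image fun t => (t, n t))) ?_
    change x ∈ (if _ then _ else _)
    rw [if_pos h0]
    intro i hi
    obtain ⟨t, -, rfl⟩ := Finset.mem_image.1 hi
    exact hn t
  obtain ⟨k, hk⟩ := hfip
  exact ⟨k, fun t hkt => (hFd t (n t)).notMem_of_mem_left (mem_iInter.1 hk t) hkt⟩

theorem corollary4p3
    (h : ((ℵ₁ : Cardinal.{0}) : WithTop Cardinal.{0}) < cov (nullIdealCantor ℵ₁))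
    {K : Type*} [TopologicalSpace K] [CompactSpace K] [T2Space K]
    [MeasurableSpace K] [BorelSpace K]
    (μ : Measure K) [IsFiniteMeasure μ] [μ.InnerRegular] (hμ : μ ≠ 0) :
    ((ℵ₁ : Cardinal) : WithTop Cardinal) < cov (nullIdeal μ) := by
  set T := (ℵ₁ : Cardinal.{0}).out with hT
  have hTc : #T = ℵ₁ := Cardinal.mk_out _
  have : Infinite T := Cardinal.infinite_iff.2 (hTc ▸ Cardinal.aleph0_le_aleph 1)
  have : NeZero μ := ⟨hμ⟩
  refine lt_cov_iff.2 fun A hA hU => not_le.1 fun hle => ?_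
  have hKne : Nonempty K := by
    by_contra hK
    rw [not_nonempty_iff] at hK
    exact hμ μ.eq_zero_of_isEmpty
  have hAne : Nonempty A := by
    obtain ⟨k⟩ := hKne
    obtain ⟨N, hN, -⟩ := hU ▸ mem_univ k
    exact ⟨N, hN⟩
  -- Index the cover by `T`, with repetitions if it is smaller.
  obtain ⟨g, hg⟩ : ∃ g : T → A, Function.Surjective g := by
    have hl : Cardinal.lift.{0} #A ≤ Cardinal.lift #T := by
      rw [hTc]; simpa using hle
    obtain ⟨i⟩ := Cardinal.lift_mk_le'.1 hl
    exact ⟨Function.invFun i, Function.invFun_surjective i.injective⟩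
  obtain ⟨k, hk⟩ := exists_forall_notMem_null_of_lt_cov_cantorMeasure (T := T) (by rw [hTc]; exact h)
    ((μ univ)⁻¹ • μ) (N := fun t => (g t : Set K)) fun t => by
      simp [show μ (g t) = 0 from hA (g t).2]
  obtain ⟨N, hN, hkN⟩ := hU ▸ mem_univ k
  obtain ⟨t, ht⟩ := hg ⟨N, hN⟩
  exact hk t (by rwa [ht])
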